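/- A finite noncompact graph $\mathcal G=(V,\mathcal I,\mathcal E,\partial)$ consists of a finite set $V$ of vertices, a finite set $\mathcal I$ of internal edges, a finite set $\mathcal E$ of external edges, and a map $\partial$ that assigns to every $i\in\mathcal I$ an ordered pair of (possibly equal) end vertices and to every $e\in\mathcal E$ a single vertex $\partial(e)$; distinct edges may have the same end vertices. A metric graph $(\mathcal G,\underline a)$ is such a graph together with lengths $a_i>0$, $i\in\mathcal I$. Its interior is $\mathcal G_{\mathrm{int}}=(V,\mathcal I,\emptyset,\partial|_{\mathcal I})$. A walk from $e'\in\mathcal E$ to $e\in\mathcal E$ is a sequence $(e',i_1,\dots,i_N,e)$, $N\ge 0$, with $i_k\in\mathcal I$, for which there are vertices $v_0=\partial(e'),v_1,\dots,v_N=\partial(e)$ such that for each $k=1,\dots,N$ the end vertices of $i_k$ are $v_{k-1}$ and $v_k$ (in either order). Its metric length is $\sum_{k=1}^N a_{i_k}$, and $\mathcal L_{e,e'}$ denotes the set of the metric lengths of all walks from $e'$ to $e$. **Theorem.** Let $(\mathcal G,\underline a)$ and $(\mathcal G',\underline a')$ be metric graphs, each of which satisfies: (i) the graph is connected (through internal edges),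 has at least one external edge, and has no tadpoles, i.e. no internal edge whose two end vertices coincide; (ii) the lengths of its internal edges are rationally independent, i.e. $\sum_{i} n_i a_i=0$ with $n_i\in\mathbb Z$ implies that all $n_i=0$. Let $e$ and $e'$ be arbitrary external edges of $\mathcal G$ and $\mathcal G'$, respectively. If $\mathcal L_{e,e}(\mathcal G,\underline a)=\mathcal L_{e',e'}(\mathcal G',\underline a')$, then there are bijections $V\to V'$ and $\mathcal I\to\mathcal I'$ that carry $\mathcal G_{\mathrm{int}}$ to $\mathcal G'_{\mathrm{int}}$ (the pair of end vertices of each internal edge goes to the pair of end vertices of its image, up to orientation), carry $\partial(e)$ to $\partial(e')$, and preserve the edge lengths. In other words, the set $\mathcal L_{e,e}$ uniquely determines the interior graph $\mathcal G_{\mathrm{int}}$ (up to the names of vertices and edges and the orientations of the edges), the vertex $\partial(e)$ and the metric $\underline a$. -/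

import Mathlib

/-- A graph `(V, I, E, ∂)` with vertex set `V`, internal edges `I` and external edges `E`.
Each internal edge has an ordered pair of (possibly equal) end vertices, each external edge has a
single vertex. Parallel internal edges are allowed. (Finiteness is imposed on the types.) -/
structure OpenGraph (V I E : Type*) where
  /-- the initial vertex of an internal edge -/
  init : I → V
  /-- the terminal vertex of an internal edge -/
  term : I → V
  /-- the vertex of an external edge -/
  bd : E → V

namespace OpenGraph

variable {V I E : Type*}

/-- The vertex `v` is incident with the internal edge `i`. -/
def Inc (G : OpenGraph V I E) (v : V) (i : I) : Prop := v = G.init i ∨ v = G.term i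

/-- An internal edge is a tadpole if its two end vertices coincide. -/
def IsTadpole (G : OpenGraph V I E) (i : I) : Prop := G.init i = G.term i

/-- Two vertices are adjacent if some internal edge is incident with both. -/
def Adj (G : OpenGraph V I E) (v w : V) : Prop := ∃ i : I, G.Inc v i ∧ G.Inc w i

/-- Any two vertices are joined by a sequence of successively adjacent vertices. -/
def Connected (G : OpenGraph V I E) : Prop := ∀ v w : V, Relation.ReflTransGen G.Adj v w

/-- No internal edge is a tadpole. -/
def NoTadpoles (G : OpenGraph V I E) : Prop := ∀ i : I, ¬ G.IsTadpole i

/-- `G.Joins u [i₁, …, i_N] w`: there are vertices `v₀ = u, v₁, …, v_N = w` such that, for every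
`k = 1, …, N`, both `v_{k-1}` and `v_k` are incident with `i_k`, and `v_{k-1} = v_k` if and only if
`i_k` is a tadpole. -/
def Joins (G : OpenGraph V I E) : V → List I → V → Prop
  | u, [], w => u = w
  | u, i :: l, w => ∃ v : V, G.Inc u i ∧ G.Inc v i ∧ (u = v ↔ G.IsTadpole i) ∧ G.Joins v l w

/-- `(e', i₁, …, i_N, e)` is a walk from the external edge `e'` to the external edge `e`.
For `N = 0` this is the trivial walk, which exists if and only if `∂(e') = ∂(e)`. -/
def IsWalk (G : OpenGraph V I E) (e' : E) (l : List I) (e : E) : Prop :=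
  G.Joins (G.bd e') l (G.bd e)

end OpenGraph

/-- A metric graph: a graph together with a positive length for every internal edge. -/
structure MetricOpenGraph (V I E : Type*) extends OpenGraph V I E where
  /-- the length of an internal edge -/
  len : I → ℝ
  len_pos : ∀ i : I, 0 < len i

namespace MetricOpenGraph

variable {V I E V' I' E' : Type*}

/-- The interior of a metric graph: all external edges are removed. -/
def interior (G : MetricOpenGraph V I E) : MetricOpenGraph V I Empty where
  init := G.init
  term := G.term
  bd := Empty.elim
  len := G.len
  len_pos := G.len_pos

/-- The only integer solution of `∑ i, n i * a i = 0` is the trivial one. -/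
def RationallyIndependent [Fintype I] (G : MetricOpenGraph V I E) : Prop :=
  ∀ n : I → ℤ, ∑ i : I, (n i : ℝ) * G.len i = 0 → ∀ i : I, n i = 0

/-- The set of metric lengths `a_{i₁} + ⋯ + a_{i_N}` of all walks from `e'` to `e`
(with repeated edges counted each time, and the trivial walk included if there is one). -/
def walkLengths (G : MetricOpenGraph V I E) (e e' : E) : Set ℝ :=
  {x : ℝ | ∃ l : List I, G.IsWalk e' l e ∧ x = (l.map G.len).sum}

/-- An isomorphism of metric graphs: bijections of vertices, internal edges and external edges that
respect incidence (internal edges up to orientation) and the lengths. -/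
structure Iso (G : MetricOpenGraph V I E) (G' : MetricOpenGraph V' I' E') where
  onV : V ≃ V'
  onI : I ≃ I'
  onE : E ≃ E'
  ends : ∀ i : I,
    (G'.init (onI i) = onV (G.init i) ∧ G'.term (onI i) = onV (G.term i)) ∨
    (G'.init (onI i) = onV (G.term i) ∧ G'.term (onI i) = onV (G.init i))
  bd_eq : ∀ e : E, G'.bd (onE e) = onV (G.bd e)
  len_eq : ∀ i : I, G'.len (onI i) = G.len i

end MetricOpenGraph

/-!
Record a closed walk at a vertex by the multiset of its edges; these multisets form a monoid, and
by rational independence a multiset of edges is determined by its length.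

*Edge lengths.* Let `L` be the monoid of closed walk lengths and `D` the monoid of all `d` such
that, for some `s`, `s + k d ∈ L` for all `k ∈ ℕ`. Every element of `D` is the length of a multiset
of edges whose boundary modulo two vanishes. Since walking back and forth along an edge `i` puts
`2 aᵢ` into `D`, whereas `aᵢ ∉ D` because `i` is not a tadpole, the numbers `2 aᵢ` are exactly the
generators of the extremal rays of `D`.

*Incidences.* Once the edges of the two graphs are identified by their lengths, both graphs have
the same multisets of closed walks. If a walk `l` exists in both graphs, then the first vertex of
`l` that is incident with a given edge `i` occurs at the same time in both: walk until there, along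
`i` and back. The closed walks modulo two then tell whether `i` also leads to the end of `l`. Hence
the two graphs have the same walks from the root, and sending the end of a walk in one graph to the
end of the same walk in the other is an isomorphism.
-/

section Generalities

open Finsupp

theorem exists_equiv_comp_eq_of_range_eq {α β γ : Type*} {f : α → γ} {g : β → γ}
    (hf : Function.Injective f) (hg : Function.Injective g) (h : Set.range f = Set.range g) :
    ∃ σ : α ≃ β, g ∘ σ = f := by
  let σ := (Equiv.ofInjective f hf).trans
    ((Equiv.setCongr h).trans (Equiv.ofInjective g hg).symm)
  exact ⟨σ, funext fun _ => Equiv.apply_ofInjective_symm hg _⟩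

theorem sum_map_injective_of_linearIndependent {ι M : Type*} [AddCommMonoid M] {v : ι → M}
    (hv : LinearIndependent ℕ v) : Function.Injective fun m : Multiset ι => (m.map v).sum := by
  classical
  have key : ((linearCombination ℕ v).toAddMonoidHom.comp
      (Multiset.toFinsupp (α := ι)).toAddMonoidHom) =
      Multiset.sumAddMonoidHom.comp (Multiset.mapAddMonoidHom v) :=
    Multiset.addHom_ext fun i => by simp
  intro m n hmn
  refine Multiset.toFinsupp.injective (hv ?_)
  exact (DFunLike.congr_fun key m).trans (hmn.trans (DFunLike.congr_fun key n).symm)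

theorem le_of_forall_nsmul_le_add_nsmul {α : Type*} {r s t : Multiset α}
    (h : ∀ k : ℕ, k • s ≤ r + k • t) : s ≤ t := by
  classical
  refine Multiset.le_iff_count.2 fun a => ?_
  have hk := Multiset.le_iff_count.1 (h (r.count a + 1)) a
  simp only [Multiset.count_add, Multiset.count_nsmul] at hk
  by_contra! hlt
  nlinarith

theorem single_add_single_eq_zero_iff {α : Type*} {a b : α} :
    (single a 1 + single b 1 : α →₀ ZMod 2) = 0 ↔ a = b := by
  rw [← ZModModule.sub_eq_add, sub_eq_zero, (single_left_injective one_ne_zero).eq_iff]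

end Generalities

section Recession

variable {A : Type*}

/-- The recession monoid of a submonoid `L`: the steps of the arithmetic progressions that are
contained in `L`. -/
def recession [AddCommMonoid A] (L : AddSubmonoid A) : AddSubmonoid A where
  carrier := {d | ∃ s, ∀ k : ℕ, s + k • d ∈ L}
  zero_mem' := ⟨0, by simp⟩
  add_mem' := by
    rintro a b ⟨s, hs⟩ ⟨t, ht⟩
    refine ⟨s + t, fun k => ?_⟩
    rw [nsmul_add, add_add_add_comm]
    exact L.add_mem (hs k) (ht k)

theorem exists_of_mem_recession_map {I : Type*} [AddCancelCommMonoid A] {f : Multiset I →+ A}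
    (hf : Function.Injective f) {L : AddSubmonoid (Multiset I)} {d : A}
    (hd : d ∈ recession (L.map f)) : ∃ m, f m = d ∧ ∃ n ∈ L, n + m ∈ L := by
  obtain ⟨s, hs⟩ := hd
  choose n hnL hn using hs
  have hn₀ : f (n 0) = s := by simpa using hn 0
  have hn₁ : f (n 1) = s + d := by simpa using hn 1
  have hle : n 0 ≤ n 1 := le_of_forall_nsmul_le_add_nsmul (r := n 0) fun k => by
    have hk : n k + k • n 0 = n 0 + k • n 1 := hf <| by
      rw [map_add, map_add, map_nsmul, map_nsmul, hn₁, hn₀, hn, nsmul_add]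
      abel
    exact hk ▸ le_add_self
  obtain ⟨m, hm⟩ := le_iff_exists_add.1 hle
  refine ⟨m, add_left_cancel (a := s) ?_, n 0, hnL 0, hm ▸ hnL 1⟩
  rw [← hn₁, hm, map_add, hn₀]

/-- `x` generates an extremal ray of the monoid `D`, in the sense that `0`, `x` and `2 x` are the
only summands of `2 x`. Asking for `2 x` instead of `x` excludes indecomposable elements that lie on
no extremal ray, such as the length `a + b + c` of a cycle when `D` contains `2 a`, `2 b`, `2 c`. -/
def IsExtremalGenerator [AddCommMonoid A] (D : AddSubmonoid A) (x : A) : Prop :=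
  x ∈ D ∧ x ≠ 0 ∧ ∀ y ∈ D, ∀ z ∈ D, y + z = 2 • x → y = 0 ∨ y = x ∨ y = 2 • x

end Recession

namespace OpenGraph

open Finsupp

variable {V I E V' I' E' : Type*}

section Walks

variable {G : OpenGraph V I E} {u v w x : V} {i : I} {l l₁ l₂ : List I}

theorem joins_cons : G.Joins u (i :: l) w ↔ ∃ v, G.Joins u [i] v ∧ G.Joins v l w := by
  simp [Joins, and_assoc]

theorem joins_append : G.Joins u (l₁ ++ l₂) w ↔ ∃ v, G.Joins u l₁ v ∧ G.Joins v l₂ w := by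
  induction l₁ generalizing u with
  | nil => simp [Joins]
  | cons i l₁ ih =>
    rw [List.cons_append, joins_cons]
    simp only [ih, joins_cons (l := l₁)]
    exact ⟨fun ⟨x, hx, v, h₁, h₂⟩ => ⟨v, ⟨x, hx, h₁⟩, h₂⟩,
      fun ⟨v, ⟨x, hx, h₁⟩, h₂⟩ => ⟨x, hx, v, h₁, h₂⟩⟩

theorem Joins.append (h₁ : G.Joins u l₁ v) (h₂ : G.Joins v l₂ w) : G.Joins u (l₁ ++ l₂) w :=
  joins_append.2 ⟨v, h₁, h₂⟩

theorem joins_singleton : G.Joins u [i] v ↔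
    (u = G.init i ∧ v = G.term i) ∨ (u = G.term i ∧ v = G.init i) := by
  constructor
  · rintro ⟨x, hu, hx, hux, rfl⟩
    simp only [Inc, IsTadpole] at hu hx hux
    grind
  · rintro (⟨rfl, rfl⟩ | ⟨rfl, rfl⟩)
    · exact ⟨_, .inl rfl, .inr rfl, Iff.rfl, rfl⟩
    · exact ⟨_, .inr rfl, .inl rfl, eq_comm, rfl⟩

theorem Joins.symm_singleton (h : G.Joins u [i] v) : G.Joins v [i] u :=
  joins_singleton.2 ((joins_singleton.1 h).symm.imp And.symm And.symm)

theorem Joins.inc_left (h : G.Joins u [i] v) : G.Inc u i :=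
  (joins_singleton.1 h).imp And.left And.left

theorem Joins.inc_right (h : G.Joins u [i] v) : G.Inc v i :=
  h.symm_singleton.inc_left

theorem Inc.exists_joins (h : G.Inc u i) : ∃ v, G.Joins u [i] v := by
  rcases h with h | h
  · exact ⟨_, joins_singleton.2 (.inl ⟨h, rfl⟩)⟩
  · exact ⟨_, joins_singleton.2 (.inr ⟨h, rfl⟩)⟩

theorem Inc.eq_or_eq (h : G.Inc x i) (hi : G.Joins u [i] v) : x = u ∨ x = v := by
  rw [joins_singleton] at hi
  unfold Inc at h
  grind

theorem Inc.eq_or_joins (hu : G.Inc u i) (hv : G.Inc v i) : u = v ∨ G.Joins u [i] v := by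
  obtain ⟨w, hw⟩ := hu.exists_joins
  rcases hv.eq_or_eq hw with rfl | rfl
  · exact .inl rfl
  · exact .inr hw

theorem Joins.reverse (h : G.Joins u l v) : G.Joins v l.reverse u := by
  induction l generalizing u with
  | nil => exact Eq.symm h
  | cons i l ih =>
    obtain ⟨w, hi, hl⟩ := joins_cons.1 h
    rw [List.reverse_cons]
    exact (ih hl).append hi.symm_singleton

theorem Joins.exists_of_prefix (h : G.Joins u l v) (hp : l₁ <+: l) : ∃ w, G.Joins u l₁ w := by
  obtain ⟨l₂, rfl⟩ := hp
  exact (joins_append.1 h).imp fun _ => And.left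

theorem Connected.exists_joins (hc : G.Connected) (u v : V) : ∃ l, G.Joins u l v := by
  induction hc u v with
  | refl => exact ⟨[], rfl⟩
  | tail _ hxy ih =>
    obtain ⟨l, hl⟩ := ih
    obtain ⟨i, hx, hy⟩ := hxy
    rcases hx.eq_or_joins hy with rfl | hi
    · exact ⟨l, hl⟩
    · exact ⟨l ++ [i], hl.append hi⟩

theorem Joins.exists_prefix_of_mem (h : G.Joins u l v) (hi : i ∈ l) (hx : G.Inc x i) :
    ∃ p, p <+: l ∧ G.Joins u p x := by
  obtain ⟨l₁, l₂, rfl⟩ := List.append_of_mem hi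
  obtain ⟨a, h₁, h₂⟩ := joins_append.1 h
  obtain ⟨b, hab, -⟩ := joins_cons.1 h₂
  rcases hx.eq_or_eq hab with rfl | rfl
  · exact ⟨l₁, List.prefix_append _ _, h₁⟩
  · exact ⟨l₁ ++ [i], ⟨l₂, by simp⟩, h₁.append hab⟩

theorem Joins.exists_prefix_inc {l' : List I} (h : G.Joins u l v) (h' : G.Joins u l' w)
    (hl' : ∀ j ∈ l', j = i ∨ j ∈ l) (hi : i ∈ l') :
    ∃ p x, p <+: l ∧ G.Joins u p x ∧ G.Inc x i := by
  -- The edge just before the first occurrence of `i`, if there is one, belongs to `l`.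
  obtain ⟨l₁, l₂, rfl, hi₁⟩ := List.eq_append_cons_of_mem hi
  obtain ⟨x, h₁, h₂⟩ := joins_append.1 h'
  obtain ⟨_, hxi, -⟩ := joins_cons.1 h₂
  suffices ∃ p, p <+: l ∧ G.Joins u p x from this.imp fun p hp => ⟨x, hp.1, hp.2, hxi.inc_left⟩
  rcases l₁.eq_nil_or_concat' with rfl | ⟨l₀, j, rfl⟩
  · exact ⟨[], List.nil_prefix, h₁⟩
  · obtain ⟨_, -, hj⟩ := joins_append.1 h₁
    have hjl : j ∈ l := (hl' j (by simp)).resolve_left fun hji => hi₁ (by simp [hji])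
    exact h.exists_prefix_of_mem hjl hj.inc_right

end Walks

section Boundary

/-- The boundary modulo two of a multiset of edges: the sum of the end vertices of its members. -/
noncomputable def boundary (G : OpenGraph V I E) : Multiset I →+ (V →₀ ZMod 2) :=
  Multiset.sumAddMonoidHom.comp
    (Multiset.mapAddMonoidHom fun i => single (G.init i) 1 + single (G.term i) 1)

variable {G : OpenGraph V I E} {u v w : V} {l l₁ l₂ : List I}

theorem boundary_singleton (i : I) :
    G.boundary {i} = single (G.init i) 1 + single (G.term i) 1 := by
  simp [boundary]

theorem NoTadpoles.boundary_singleton_ne_zero (hG : G.NoTadpoles) (i : I) :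
    G.boundary {i} ≠ 0 := by
  rw [boundary_singleton, Ne, single_add_single_eq_zero_iff]
  exact hG i

theorem Joins.boundary_eq (h : G.Joins u l v) : G.boundary l = single u 1 + single v 1 := by
  induction l generalizing u with
  | nil =>
    obtain rfl : u = v := h
    rw [ZModModule.add_self, Multiset.coe_nil, map_zero]
  | cons i l ih =>
    obtain ⟨w, hi, hl⟩ := joins_cons.1 h
    have hi' : G.boundary {i} = single u 1 + single w 1 := by
      rw [boundary_singleton]
      rcases joins_singleton.1 hi with ⟨rfl, rfl⟩ | ⟨rfl, rfl⟩
      · rfl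
      · exact add_comm _ _
    rw [← Multiset.cons_coe, ← Multiset.singleton_add, map_add, hi', ih hl,
      ZModModule.add_add_add_cancel]

end Boundary

section ClosedWalks

/-- The multisets of edges of the closed walks at a vertex. -/
def closedWalks (G : OpenGraph V I E) (r : V) : AddSubmonoid (Multiset I) where
  carrier := {m | ∃ l, G.Joins r l r ∧ (l : Multiset I) = m}
  zero_mem' := ⟨[], rfl, rfl⟩
  add_mem' := by
    rintro _ _ ⟨l₁, h₁, rfl⟩ ⟨l₂, h₂, rfl⟩
    exact ⟨l₁ ++ l₂, h₁.append h₂, (Multiset.coe_add _ _).symm⟩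

variable {G : OpenGraph V I E} {r v : V} {i : I} {l : List I} {m : Multiset I}

theorem boundary_eq_zero_of_mem_closedWalks (hm : m ∈ G.closedWalks r) : G.boundary m = 0 := by
  obtain ⟨l, hl, rfl⟩ := hm
  rw [hl.boundary_eq, ZModModule.add_self]

theorem Joins.two_nsmul_add_mem_closedWalks (h : G.Joins r l v) (hm : m ∈ G.closedWalks v) :
    2 • (l : Multiset I) + m ∈ G.closedWalks r := by
  obtain ⟨c, hc, rfl⟩ := hm
  refine ⟨l ++ c ++ l.reverse, (h.append hc).append h.reverse, ?_⟩
  rw [← Multiset.coe_add, ← Multiset.coe_add, Multiset.coe_reverse]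
  abel

theorem Inc.two_nsmul_singleton_mem_closedWalks (h : G.Inc v i) :
    2 • {i} ∈ G.closedWalks v := by
  obtain ⟨w, hw⟩ := h.exists_joins
  simpa using hw.two_nsmul_add_mem_closedWalks (G.closedWalks w).zero_mem

end ClosedWalks

section Reconstruction

variable {G : OpenGraph V I E} {G' : OpenGraph V' I E'} {r u v : V} {r' u' v' w' : V'}
  {i : I} {l l₁ l₂ : List I}

theorem end_eq_of_closedWalks_le (hle : G.closedWalks r ≤ G'.closedWalks r')
    (h₁ : G.Joins r l₁ v) (h₂ : G.Joins r l₂ v) (h₁' : G'.Joins r' l₁ v')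
    (h₂' : G'.Joins r' l₂ w') : v' = w' := by
  have hclosed : (l₁ : Multiset I) + l₂ ∈ G.closedWalks r :=
    ⟨l₁ ++ l₂.reverse, h₁.append h₂.reverse, by rw [← Multiset.coe_add, Multiset.coe_reverse]⟩
  have hzero := boundary_eq_zero_of_mem_closedWalks (hle hclosed)
  rwa [map_add, h₁'.boundary_eq, h₂'.boundary_eq, add_comm (single r' 1),
    ZModModule.add_add_add_cancel, single_add_single_eq_zero_iff] at hzero

theorem exists_prefix_inc_of_closedWalks_le (hle : G.closedWalks r ≤ G'.closedWalks r')
    (hl : G.Joins r l u) (hi : G.Inc u i) (hl' : G'.Joins r' l u') :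
    ∃ p x', p <+: l ∧ G'.Joins r' p x' ∧ G'.Inc x' i := by
  obtain ⟨c, hc, hcl⟩ :=
    hle (hl.two_nsmul_add_mem_closedWalks hi.two_nsmul_singleton_mem_closedWalks)
  have hmem : ∀ j, j ∈ c ↔ j ∈ l ∨ j = i := fun j => by
    rw [← Multiset.mem_coe, hcl]
    simp [Multiset.mem_nsmul]
  exact hl'.exists_prefix_inc hc (fun j hj => ((hmem j).1 hj).symm) ((hmem i).2 (.inr rfl))

theorem exists_common_prefix_inc (heq : G.closedWalks r = G'.closedWalks r')
    (hl : G.Joins r l u) (hi : G.Inc u i) (hl' : G'.Joins r' l u') :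
    ∃ p x x', p <+: l ∧ G.Joins r p x ∧ G.Inc x i ∧ G'.Joins r' p x' ∧ G'.Inc x' i := by
  induction hn : l.length using Nat.strong_induction_on generalizing l u u' with | _ n ih
  obtain ⟨p, y', hpl, hp', hy'⟩ := exists_prefix_inc_of_closedWalks_le heq.le hl hi hl'
  by_cases hne : p = l
  · subst hne
    exact ⟨p, u, y', hpl, hl, hi, hp', hy'⟩
  obtain ⟨y, hp⟩ := hl.exists_of_prefix hpl
  obtain ⟨q, x, hqp, hq, hx⟩ := exists_prefix_inc_of_closedWalks_le heq.ge hp' hy' hp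
  obtain ⟨x', hq'⟩ := hp'.exists_of_prefix hqp
  have hlt : q.length < l.length :=
    hqp.length_le.trans_lt (hpl.length_le.lt_of_ne fun h => hne (hpl.eq_of_length h))
  obtain ⟨s, z, z', hsq, hs⟩ := ih _ (hn ▸ hlt) hq hx hq' rfl
  exact ⟨s, z, z', hsq.trans (hqp.trans hpl), hs⟩

theorem inc_of_closedWalks_eq (heq : G.closedWalks r = G'.closedWalks r')
    (hl : G.Joins r l u) (hi : G.Inc u i) (hl' : G'.Joins r' l u') : G'.Inc u' i := by
  obtain ⟨p, x, x', -, hp, hx, hp', hx'⟩ := exists_common_prefix_inc heq hl hi hl'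
  rcases hx.eq_or_joins hi with rfl | hxu
  · rwa [end_eq_of_closedWalks_le heq.le hl hp hl' hp']
  · obtain ⟨y', hy'⟩ := hx'.exists_joins
    rw [end_eq_of_closedWalks_le heq.le hl (hp.append hxu) hl' (hp'.append hy')]
    exact hy'.inc_right

theorem exists_joins_of_closedWalks_eq (heq : G.closedWalks r = G'.closedWalks r')
    (hl : G.Joins r l v) : ∃ v', G'.Joins r' l v' := by
  induction l using List.reverseRecOn generalizing v with
  | nil => exact ⟨r', rfl⟩
  | append_singleton l i ih =>
    obtain ⟨u, hu, hi⟩ := joins_append.1 hl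
    obtain ⟨u', hu'⟩ := ih hu
    obtain ⟨v', hv'⟩ := (inc_of_closedWalks_eq heq hu hi.inc_left hu').exists_joins
    exact ⟨v', hu'.append hv'⟩

theorem exists_common_walk (hc : G.Connected) (heq : G.closedWalks r = G'.closedWalks r') (v : V) :
    ∃ v' l, G.Joins r l v ∧ G'.Joins r' l v' := by
  obtain ⟨l, hl⟩ := hc.exists_joins r v
  obtain ⟨v', hl'⟩ := exists_joins_of_closedWalks_eq heq hl
  exact ⟨v', l, hl, hl'⟩

theorem exists_equiv_of_closedWalks_eq (hc : G.Connected) (hc' : G'.Connected)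
    (heq : G.closedWalks r = G'.closedWalks r') :
    ∃ φ : V ≃ V', ∀ l v, G.Joins r l v ↔ G'.Joins r' l (φ v) := by
  choose f p hp hp' using exists_common_walk hc heq
  choose g q hq' hq using exists_common_walk hc' heq.symm
  have hf {l v v'} (h : G.Joins r l v) (h' : G'.Joins r' l v') : f v = v' :=
    end_eq_of_closedWalks_le heq.le (hp v) h (hp' v) h'
  have hg {l v v'} (h : G.Joins r l v) (h' : G'.Joins r' l v') : g v' = v :=
    end_eq_of_closedWalks_le heq.ge (hq' v') h' (hq v') h
  refine ⟨⟨f, g, fun v => hg (hp v) (hp' v), fun v' => hf (hq v') (hq' v')⟩, fun l v => ⟨?_, ?_⟩⟩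
  · intro h
    obtain ⟨v', h'⟩ := exists_joins_of_closedWalks_eq heq h
    rwa [Equiv.coe_fn_mk, hf h h']
  · intro h'
    obtain ⟨w, h⟩ := exists_joins_of_closedWalks_eq heq.symm h'
    obtain rfl : w = v := (hg h h').symm.trans (hg (hp v) (hp' v))
    exact h

theorem exists_equiv_ends_of_closedWalks_eq (hc : G.Connected) (hc' : G'.Connected)
    (heq : G.closedWalks r = G'.closedWalks r') :
    ∃ φ : V ≃ V', φ r = r' ∧ ∀ i,
      (G'.init i = φ (G.init i) ∧ G'.term i = φ (G.term i)) ∨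
      (G'.init i = φ (G.term i) ∧ G'.term i = φ (G.init i)) := by
  obtain ⟨φ, hφ⟩ := exists_equiv_of_closedWalks_eq hc hc' heq
  refine ⟨φ, ((hφ [] r).1 rfl).symm, fun i => ?_⟩
  obtain ⟨l, hl⟩ := hc.exists_joins r (G.init i)
  have hli : G.Joins r (l ++ [i]) (G.term i) :=
    hl.append (joins_singleton.2 (.inl ⟨rfl, rfl⟩))
  obtain ⟨u', hu', hi'⟩ := joins_append.1 ((hφ _ _).1 hli)
  obtain rfl : φ (G.init i) = u' :=
    end_eq_of_closedWalks_le heq.le hl hl ((hφ _ _).1 hl) hu'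
  grind [joins_singleton]

end Reconstruction

section ComapEdges

/-- The graph whose edges are renamed along a bijection. -/
def comapEdges (G : OpenGraph V I' E) (σ : I ≃ I') : OpenGraph V I E where
  init := G.init ∘ σ
  term := G.term ∘ σ
  bd := G.bd

variable {G : OpenGraph V I' E} {σ : I ≃ I'}

theorem joins_comapEdges {l : List I} {u w : V} :
    (G.comapEdges σ).Joins u l w ↔ G.Joins u (l.map σ) w := by
  induction l generalizing u with
  | nil => rfl
  | cons i l ih =>
    rw [List.map_cons, joins_cons, joins_cons]
    exact exists_congr fun v => and_congr Iff.rfl ih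

theorem Connected.comapEdges (h : G.Connected) (σ : I ≃ I') : (G.comapEdges σ).Connected :=
  fun v w => Relation.ReflTransGen.mono (fun _ _ ⟨i, hx, hy⟩ =>
    ⟨σ.symm i, by simpa [Inc, OpenGraph.comapEdges] using hx,
      by simpa [Inc, OpenGraph.comapEdges] using hy⟩) _ _ (h v w)

theorem map_closedWalks_comapEdges (r : V) :
    ((G.comapEdges σ).closedWalks r).map (Multiset.mapAddMonoidHom σ) = G.closedWalks r := by
  ext m
  constructor
  · rintro ⟨_, ⟨l, hl, rfl⟩, rfl⟩
    exact ⟨l.map σ, joins_comapEdges.1 hl, rfl⟩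
  · rintro ⟨l, hl, rfl⟩
    exact ⟨l.map σ.symm, ⟨_, joins_comapEdges.2 (by simpa using hl), rfl⟩, by simp⟩

end ComapEdges

end OpenGraph

namespace MetricOpenGraph

variable {V I E V' I' E' : Type*}

/-- The total length of a multiset of edges. -/
noncomputable def length (G : MetricOpenGraph V I E) : Multiset I →+ ℝ :=
  Multiset.sumAddMonoidHom.comp (Multiset.mapAddMonoidHom G.len)

/-- The monoid of lengths of the closed walks at a vertex. -/
noncomputable def closedLengths (G : MetricOpenGraph V I E) (r : V) : AddSubmonoid ℝ :=
  (G.closedWalks r).map G.length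

section EdgeLengths

variable {G : MetricOpenGraph V I E} {r : V} {i : I} {x : ℝ}

theorem length_singleton (i : I) : G.length {i} = G.len i := by
  simp [length]

theorem coe_closedLengths (e : E) : (G.closedLengths (G.bd e) : Set ℝ) = G.walkLengths e e := by
  ext x
  constructor
  · rintro ⟨_, ⟨l, hl, rfl⟩, rfl⟩
    exact ⟨l, hl, by simp [length]⟩
  · rintro ⟨l, hl, rfl⟩
    exact ⟨l, ⟨l, hl, rfl⟩, by simp [length]⟩

theorem RationallyIndependent.linearIndependent [Fintype I] (h : G.RationallyIndependent) :
    LinearIndependent ℤ G.len :=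
  Fintype.linearIndependent_iff.2 fun n hn => h n (by simpa using hn)

theorem length_injective (h : LinearIndependent ℤ G.len) : Function.Injective G.length :=
  sum_map_injective_of_linearIndependent (h.restrict_scalars' ℕ)

theorem exists_of_mem_recession_closedLengths (hlen : Function.Injective G.length)
    (hx : x ∈ recession (G.closedLengths r)) : ∃ m, G.length m = x ∧ G.boundary m = 0 := by
  obtain ⟨m, hm, n, hn, hnm⟩ := exists_of_mem_recession_map hlen hx
  refine ⟨m, hm, ?_⟩
  simpa [OpenGraph.boundary_eq_zero_of_mem_closedWalks hn] using
    OpenGraph.boundary_eq_zero_of_mem_closedWalks hnm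

theorem two_nsmul_len_mem_recession (hc : G.Connected) (r : V) (i : I) :
    2 • G.len i ∈ recession (G.closedLengths r) := by
  obtain ⟨l, hl⟩ := hc.exists_joins r (G.init i)
  have hi : G.Inc (G.init i) i := .inl rfl
  refine ⟨G.length (2 • l), fun k => ?_⟩
  refine ⟨_, hl.two_nsmul_add_mem_closedWalks
    (nsmul_mem hi.two_nsmul_singleton_mem_closedWalks k), ?_⟩
  rw [map_add, map_nsmul, map_nsmul, ← length_singleton, map_nsmul]

theorem len_notMem_recession (hlen : Function.Injective G.length) (hG : G.NoTadpoles) (r : V)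
    (i : I) : G.len i ∉ recession (G.closedLengths r) := by
  intro hi
  obtain ⟨m, hm, hm₀⟩ := exists_of_mem_recession_closedLengths hlen hi
  obtain rfl : m = {i} := hlen (hm.trans (length_singleton i).symm)
  exact hG.boundary_singleton_ne_zero i hm₀

theorem exists_of_isExtremalGenerator (hlen : Function.Injective G.length) (hc : G.Connected)
    (hG : G.NoTadpoles) (hx : IsExtremalGenerator (recession (G.closedLengths r)) x) :
    ∃ i, x = 2 • G.len i := by
  obtain ⟨hxD, hx₀, hext⟩ := hx
  obtain ⟨m, rfl, -⟩ := exists_of_mem_recession_closedLengths hlen hxD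
  obtain ⟨i, hi⟩ := Multiset.exists_mem_of_ne_zero (ne_of_apply_ne G.length (by simpa using hx₀))
  obtain ⟨n, rfl⟩ := Multiset.exists_cons_of_mem hi
  have hn : 2 • G.length n ∈ recession (G.closedLengths r) := by
    have : 2 • G.length n = (n.map fun j => 2 • G.len j).sum := Multiset.sum_map_nsmul.symm
    rw [this]
    refine multiset_sum_mem _ fun y hy => ?_
    obtain ⟨j, -, rfl⟩ := Multiset.mem_map.1 hy
    exact two_nsmul_len_mem_recession hc r j
  have hsplit : 2 • G.len i + 2 • G.length n = 2 • G.length (i ::ₘ n) := by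
    rw [← nsmul_add, ← length_singleton, ← map_add, Multiset.singleton_add]
  rcases hext _ (two_nsmul_len_mem_recession hc r i) _ hn hsplit with h | h | h
  · exact absurd h (smul_ne_zero two_ne_zero (G.len_pos i).ne')
  · exact ⟨i, h.symm⟩
  · rw [← nsmul_right_injective two_ne_zero h] at hxD
    exact absurd hxD (len_notMem_recession hlen hG r i)

theorem isExtremalGenerator_two_nsmul_len (hlen : Function.Injective G.length) (hc : G.Connected)
    (hG : G.NoTadpoles) (r : V) (i : I) :
    IsExtremalGenerator (recession (G.closedLengths r)) (2 • G.len i) := by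
  refine ⟨two_nsmul_len_mem_recession hc r i, smul_ne_zero two_ne_zero (G.len_pos i).ne',
    fun y hy z hz hyz => ?_⟩
  obtain ⟨m, rfl, hm⟩ := exists_of_mem_recession_closedLengths hlen hy
  obtain ⟨n, rfl, -⟩ := exists_of_mem_recession_closedLengths hlen hz
  have hmn : m + n = Multiset.replicate 4 i := hlen <| by
    rw [map_add, hyz, ← Multiset.nsmul_singleton, map_nsmul, length_singleton, ← mul_nsmul]
  obtain ⟨k, hk, rfl⟩ : ∃ k ≤ 4, m = Multiset.replicate k i :=
    Multiset.le_replicate_iff.1 (hmn ▸ Multiset.le_add_right m n)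
  have hlen_k : G.length (Multiset.replicate k i) = k • G.len i := by
    rw [← Multiset.nsmul_singleton, map_nsmul, length_singleton]
  have hk_even : Even k := by
    by_contra hodd
    obtain ⟨j, rfl⟩ := Nat.not_even_iff_odd.1 hodd
    refine hG.boundary_singleton_ne_zero i ?_
    rwa [← Multiset.nsmul_singleton, map_nsmul, add_nsmul, mul_nsmul, two_nsmul,
      ZModModule.add_self, smul_zero, zero_add, one_nsmul] at hm
  rw [hlen_k]
  obtain ⟨j, rfl⟩ := hk_even
  have hj : j ≤ 2 := by lia
  interval_cases j
  · simp
  · simp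
  · right; right
    rw [← mul_nsmul]

theorem isExtremalGenerator_recession_iff (hlen : Function.Injective G.length) (hc : G.Connected)
    (hG : G.NoTadpoles) :
    IsExtremalGenerator (recession (G.closedLengths r)) x ↔ ∃ i, x = 2 • G.len i :=
  ⟨exists_of_isExtremalGenerator hlen hc hG,
    fun ⟨i, hi⟩ => hi ▸ isExtremalGenerator_two_nsmul_len hlen hc hG r i⟩

theorem mem_range_len_iff (hlen : Function.Injective G.length) (hc : G.Connected)
    (hG : G.NoTadpoles) (r : V) :
    x ∈ Set.range G.len ↔ IsExtremalGenerator (recession (G.closedLengths r)) (2 • x) := by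
  rw [isExtremalGenerator_recession_iff hlen hc hG]
  exact exists_congr fun i => by rw [(nsmul_right_injective two_ne_zero).eq_iff, eq_comm]

end EdgeLengths

section Comparison

variable {G : MetricOpenGraph V I E} {G' : MetricOpenGraph V' I' E'} {r : V} {r' : V'}

theorem exists_equiv_len_of_closedLengths_eq (hc : G.Connected) (hc' : G'.Connected)
    (hG : G.NoTadpoles) (hG' : G'.NoTadpoles) (hind : LinearIndependent ℤ G.len)
    (hind' : LinearIndependent ℤ G'.len) (hL : G.closedLengths r = G'.closedLengths r') :
    ∃ σ : I ≃ I', G'.len ∘ σ = G.len := by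
  refine exists_equiv_comp_eq_of_range_eq hind.injective hind'.injective (Set.ext fun x => ?_)
  rw [mem_range_len_iff (length_injective hind) hc hG r, hL,
    mem_range_len_iff (length_injective hind') hc' hG' r']

theorem closedWalks_eq_comapEdges (hind : LinearIndependent ℤ G.len) {σ : I ≃ I'}
    (hσ : G'.len ∘ σ = G.len) (hL : G.closedLengths r = G'.closedLengths r') :
    G.closedWalks r = (G'.comapEdges σ).closedWalks r' := by
  have hlen : G'.length.comp (Multiset.mapAddMonoidHom σ) = G.length :=
    Multiset.addHom_ext fun i => by simp [length, ← hσ]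
  refine AddSubmonoid.map_injective_of_injective (length_injective hind) (hL.trans ?_)
  rw [closedLengths, ← OpenGraph.map_closedWalks_comapEdges (σ := σ), AddSubmonoid.map_map, hlen]

end Comparison

end MetricOpenGraph

theorem theorem1_general
    {V I E V' I' E' : Type*}
    (G : MetricOpenGraph V I E) (G' : MetricOpenGraph V' I' E')
    (hconn : G.Connected) (hconn' : G'.Connected)
    (htad : G.NoTadpoles) (htad' : G'.NoTadpoles)
    (hind : LinearIndependent ℤ G.len) (hind' : LinearIndependent ℤ G'.len)
    (e : E) (e' : E')
    (hL : G.walkLengths e e = G'.walkLengths e' e') :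
    ∃ φ : MetricOpenGraph.Iso G.interior G'.interior, φ.onV (G.bd e) = G'.bd e' := by
  have hL' : G.closedLengths (G.bd e) = G'.closedLengths (G'.bd e') := SetLike.coe_injective <| by
    rw [MetricOpenGraph.coe_closedLengths, MetricOpenGraph.coe_closedLengths, hL]
  obtain ⟨σ, hσ⟩ := MetricOpenGraph.exists_equiv_len_of_closedLengths_eq
    hconn hconn' htad htad' hind hind' hL'
  obtain ⟨φ, hroot, hends⟩ := OpenGraph.exists_equiv_ends_of_closedWalks_eq
    hconn (hconn'.comapEdges σ) (MetricOpenGraph.closedWalks_eq_comapEdges hind hσ hL')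
  exact ⟨⟨φ, σ, Equiv.refl Empty, hends, fun x => x.elim, congrFun hσ⟩, hroot⟩

theorem theorem1
    {V I E V' I' E' : Type*}
    [Finite V] [Fintype I] [Finite E] [Finite V'] [Fintype I'] [Finite E']
    (G : MetricOpenGraph V I E) (G' : MetricOpenGraph V' I' E')
    (hconn : G.Connected) (hconn' : G'.Connected)
    (htad : G.NoTadpoles) (htad' : G'.NoTadpoles)
    (hind : G.RationallyIndependent) (hind' : G'.RationallyIndependent)
    (e : E) (e' : E')
    (hL : G.walkLengths e e = G'.walkLengths e' e') :
    ∃ φ : MetricOpenGraph.Iso G.interior G'.interior, φ.onV (G.bd e) = G'.bd e' :=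
  theorem1_general G G' hconn hconn' htad htad' hind.linearIndependent hind'.linearIndependent
    e e' hL
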